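/- Let $(E,\nu,H)$ be an abstract Wiener space: $E$ is a separable real Banach space, $H$ a real Hilbert space of arbitrary (finite or infinite) dimension, continuously and densely embedded in $E$ by an injective map $i$, and $\nu=\mathcal N(0,I)$. Here, for $m\in H$ and a bounded operator $S$ on $H$, a Borel measure $\rho$ on $E$ is said to be $\mathcal N(m,S)$ if $\rho$ is a Gaussian measure and, for all $L,L'\in E^*$ with representers $i^TL,i^TL'\in H$ of $L\circ i,L'\circ i$, $$\int L\,d\rho=\langle i^TL,m\rangle_H,\qquad \mathrm{Cov}_\rho(L,L')=\langle i^TL,S\,i^TL'\rangle_H .$$ For a finite family $\psi=(\psi_1,\dots,\psi_M)$ in $H$ let $\Psi_\psi:\mathbb R^M\to H$, $\Psi_\psi a=\sum_m a_m\psi_m$, and for two finite families $\varphi,\psi$ let $K_{\varphi,\psi}=\Psi_\varphi^T\Psi_\psi=(\langle\varphi_j,\psi_k\rangle)_{j,k}$, $K_\psi=K_{\psi,\psi}$. Let $\alpha,\beta,\bar\alpha,\bar\beta$ be finite families in $H$, let $a,\bar a$ be real vectors and $B,\bar B$ real symmetric matrices of matching sizes such that $I+\Psi_\beta B\Psi_\beta^T$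 and $I+\Psi_{\bar\beta}\bar B\Psi_{\bar\beta}^T$ are invertible operators on $H$ (which is automatic if $B,\bar B\succeq0$), and let $q,p$ be Gaussian measures on $E$ with $$q=\mathcal N\big(\Psi_\alpha a,(I+\Psi_\beta B\Psi_\beta^T)^{-1}\big),\qquad p=\mathcal N\big(\Psi_{\bar\alpha}\bar a,(I+\Psi_{\bar\beta}\bar B\Psi_{\bar\beta}^T)^{-1}\big).$$ Then $|I+K_\beta B|>0$ and $|I+K_{\bar\beta}\bar B|>0$. Write $(B^{-1}+K_\beta)^{-1}$ for $B(I+K_\beta B)^{-1}$; if $B$ is invertible, then so is $B^{-1}+K_\beta$, and this is literally its inverse. The divergence $\mathrm{KL}(q\|p)$ is finite (in particular $q\ll p$), and $$\begin{aligned}\mathrm{KL}(q\|p)={}&-\tfrac12\,\mathrm{tr}\big((K_\beta+K_{\beta,\bar\beta}\bar BK_{\bar\beta,\beta})(B^{-1}+K_\beta)^{-1}\big)+\tfrac12\log|I+K_\beta B|\\&+\tfrac12a^T(K_\alpha+K_{\alpha,\bar\beta}\bar BK_{\bar\beta,\alpha})a-a^T(K_{\alpha,\bar\alpha}+K_{\alpha,\bar\beta}\bar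 BK_{\bar\beta,\bar\alpha})\bar a+C,\end{aligned}$$ $$C=\tfrac12\Big(\mathrm{tr}(K_{\bar\beta}\bar B)-\log|I+K_{\bar\beta}\bar B|+\bar a^T(K_{\bar\alpha}+K_{\bar\alpha,\bar\beta}\bar BK_{\bar\beta,\bar\alpha})\bar a\Big).$$ In particular, if $p=\mathcal N(0,I)$, then $\mathrm{KL}(q\|p)$ is finite and $$\mathrm{KL}(q\|p)=\tfrac12a^TK_\alpha a+\tfrac12\log|I+K_\beta B|-\tfrac12\,\mathrm{tr}\big(K_\beta(B^{-1}+K_\beta)^{-1}\big).$$ -/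

import Mathlib

open MeasureTheory ProbabilityTheory InformationTheory
open scoped ENNReal Matrix RealInnerProductSpace

noncomputable section

namespace DecoupledGP

variable {H : Type*} [NormedAddCommGroup H] [InnerProductSpace ℝ H] [CompleteSpace H]

/-- The synthesis operator `Ψ_ψ : ℝ^M → H`, `a ↦ ∑ m, a m • ψ m`, of a finite family `ψ` in `H`. -/
def synthesis {ι : Type*} [Fintype ι] (ψ : ι → H) : EuclideanSpace ℝ ι →L[ℝ] H :=
  ∑ m, (EuclideanSpace.proj m : EuclideanSpace ℝ ι →L[ℝ] ℝ).smulRight (ψ m)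

/-- The kernel matrix `K_{φ,ψ}` of two families, with entries `⟪φ j, ψ k⟫`; as an operator it is
`Ψ_φᵀ Ψ_ψ`. -/
def kernelMatrix {ι κ : Type*} (φ : ι → H) (ψ : κ → H) : Matrix ι κ ℝ :=
  Matrix.of fun j k => ⟪φ j, ψ k⟫

/-- The operator `I + Ψ_ψ B Ψ_ψᵀ` on `H`. -/
def precision {ι : Type*} [Fintype ι] [DecidableEq ι] (ψ : ι → H) (B : Matrix ι ι ℝ) :
    H →L[ℝ] H :=
  1 + synthesis ψ ∘L (Matrix.toEuclideanCLM (𝕜 := ℝ) B) ∘L (synthesis ψ).adjoint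

/-- For positive semidefinite `B` the operator `I + Ψ_ψ B Ψ_ψᵀ` is always invertible. -/
theorem isUnit_precision {ι : Type*} [Fintype ι] [DecidableEq ι] (ψ : ι → H)
    {B : Matrix ι ι ℝ} (hB : B.PosSemidef) : IsUnit (precision ψ B) := by
  have hT : (synthesis ψ ∘L (Matrix.toEuclideanCLM (𝕜 := ℝ) B) ∘L
      (synthesis ψ).adjoint).IsPositive := by
    refine ContinuousLinearMap.IsPositive.conj_adjoint ?_ _
    rw [← ContinuousLinearMap.isPositive_toLinearMap_iff,
      Matrix.coe_toEuclideanCLM_eq_toEuclideanLin]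
    exact Matrix.isPositive_toEuclideanLin_iff.mpr hB
  refine ContinuousLinearMap.isUnit_of_forall_le_norm_inner_map _ (c := 1) one_pos fun x => ?_
  have hx := hT.inner_nonneg_left x
  rw [precision, add_apply, inner_add_left, one_apply_eq_self,
    real_inner_self_eq_norm_sq, NNReal.coe_one, mul_one]
  exact (le_add_of_nonneg_right hx).trans (Real.le_norm_self _)

variable {E : Type*} [NormedAddCommGroup E] [NormedSpace ℝ E] [MeasurableSpace E]

/-- The representer in `H` of the restriction to `H` of a functional `L` on `E` (that is, `iᵀ L`):
`⟪representer i L, h⟫ = L (i h)`. -/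
def representer (i : H →L[ℝ] E) (L : StrongDual ℝ E) : H :=
  (InnerProductSpace.toDual ℝ H).symm (L ∘L i)

/-- `ρ = N(m, S)`, for `m : H` and a bounded operator `S` on the Hilbert space `H` embedded in `E`
by `i`: the measure `ρ` on `E` is Gaussian, every `L` in the dual of `E` has mean `⟪iᵀ L, m⟫`, and
every two such functionals `L`, `L'` have covariance `⟪iᵀ L, S (iᵀ L')⟫`. -/
structure IsGaussianWith (i : H →L[ℝ] E) (ρ : Measure E) (m : H) (S : H →L[ℝ] H) : Prop where
  isGaussian : IsGaussian ρ
  mean_eq : ∀ L : StrongDual ℝ E, ∫ x, L x ∂ρ = ⟪representer i L, m⟫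
  cov_eq : ∀ L L' : StrongDual ℝ E,
    cov[fun x => L x, fun x => L' x; ρ] = ⟪representer i L, S (representer i L')⟫

/-- `(E, ν, H)` is an abstract Wiener space: `H` is embedded densely and continuously in `E`,
and `ν = N(0, I)`. -/
structure IsAbstractWienerSpace (i : H →L[ℝ] E) (ν : Measure E) : Prop where
  injective : Function.Injective i
  denseRange : DenseRange i
  standard : IsGaussianWith i ν 0 1

/-- `ρ = N(Ψ_α a, (I + Ψ_β B Ψ_βᵀ)⁻¹)`, where the inverse is required to exist. -/
structure IsSubspaceGaussian {ι κ : Type*} [Fintype ι] [Fintype κ] [DecidableEq κ]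
    (i : H →L[ℝ] E) (ρ : Measure E) (α : ι → H) (a : ι → ℝ) (β : κ → H) (B : Matrix κ κ ℝ) :
    Prop where
  isUnit : IsUnit (precision β B)
  gaussian : IsGaussianWith i ρ (synthesis α (WithLp.toLp 2 a)) (Ring.inverse (precision β B))

end DecoupledGP

end

open DecoupledGP

/-!
The representers `iᵀ L` are dense in `H`, and `iᵀ L ↦ L` is an isometry into `L²(ν)`. Its extension
`W : H → L²(ν)`, the Paley–Wiener map `wienerMap`, makes `(W g)` a centred Gaussian family with
covariance `⟪g, g'⟫`; in particular orthogonal vectors give independent variables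
(`iIndepFun_wienerMap`).

Diagonalize `I + Ψ_β B Ψ_βᵀ` on the span of `β` and of the mean `m`: there is a finite orthonormal
family `e` with eigenvalues `1 + l j` and `m = ∑ j, c j • e j` (`exists_isDiagonalization`), and
`1 + l j > 0` because a covariance is nonnegative. The measure with `ν`-density
`∏ j, dN(c j, (1 + l j)⁻¹) / dN(0, 1) (W (e j))` has the characteristic function of
`N(m, (I + Ψ_β B Ψ_βᵀ)⁻¹)`: split a functional into its part along `e` and the independent
orthogonal part, and integrate factor by factor. Hence it is that Gaussian measure
(`IsGaussianWith.eq_wienerDensityMeasure`).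

So `q` and `p` both have positive densities with respect to `ν`, whose logarithms are quadratic
polynomials in finitely many `W g`, each in its own eigenbasis. Under `q` the variable `W g` is
Gaussian with mean `⟪g, m⟫` and variance `⟪g, S g⟫`, where `S` is the covariance operator of `q`
(`map_wienerMap_wienerDensityMeasure`), so `KL(q‖p)`, the difference of the `q`-integrals of the
two logarithms, is explicit (`integral_wienerLogDensity`). Spectral data turn into kernel matrices
by the Woodbury identity for `S` (`inverse_precision`), Sylvester's determinant identity
(`IsDiagonalization.det_eq`) and the cyclicity of the trace
(`IsDiagonalization.sum_mul_inner_precision`). The two bases never have to be compared.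
-/

namespace DecoupledGP

/-! ### The Paley–Wiener map -/

section Wiener

/-- The phase `exp (i f)` depends continuously on `f ∈ L²`. -/
lemma continuous_integral_cexp_mul_I {Ω : Type*} [MeasurableSpace Ω] {ν : Measure Ω}
    [IsProbabilityMeasure ν] :
    Continuous fun f : Lp ℝ 2 ν => ∫ x, Complex.exp (f x * Complex.I) ∂ν := by
  have hint (f : Lp ℝ 2 ν) : Integrable (fun x => Complex.exp (f x * Complex.I)) ν := by
    refine Integrable.of_bound (C := 1) ?_ (ae_of_all _ fun x => by
      rw [Complex.norm_exp_ofReal_mul_I])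
    have := (Lp.aestronglyMeasurable f).aemeasurable
    exact AEMeasurable.aestronglyMeasurable (by fun_prop)
  refine (LipschitzWith.of_dist_le_mul (K := 1) fun f g => ?_).continuous
  rw [dist_eq_norm, ← integral_sub (hint f) (hint g), NNReal.coe_one, one_mul, dist_eq_norm]
  have hfg : Integrable (f - g : Lp ℝ 2 ν) ν :=
    (Lp.memLp (f - g)).integrable (by norm_num)
  calc ‖∫ x, (Complex.exp (f x * Complex.I) - Complex.exp (g x * Complex.I)) ∂ν‖
      ≤ ∫ x, ‖(f - g : Lp ℝ 2 ν) x‖ ∂ν := by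
        refine norm_integral_le_of_norm_le hfg.norm ?_
        filter_upwards [Lp.coeFn_sub f g] with x hx
        -- `|exp (i s) - exp (i t)| ≤ |s - t|`
        rw [hx, Pi.sub_apply, mul_comm, mul_comm (g x : ℂ)]
        have h : Complex.exp (Complex.I * f x) - Complex.exp (Complex.I * g x)
            = Complex.exp (Complex.I * g x) *
              (Complex.exp (Complex.I * ((f x - g x : ℝ) : ℂ)) - 1) := by
          rw [mul_sub, ← Complex.exp_add]
          push_cast
          ring_nf
        rw [h, norm_mul, mul_comm Complex.I (g x : ℂ), Complex.norm_exp_ofReal_mul_I, one_mul]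
        exact Real.norm_exp_I_mul_ofReal_sub_one_le
    _ = (eLpNorm (f - g : Lp ℝ 2 ν) 1 ν).toReal := by
        rw [integral_norm_eq_lintegral_enorm hfg.aestronglyMeasurable,
          eLpNorm_one_eq_lintegral_enorm]
    _ ≤ ‖f - g‖ := by
        rw [Lp.norm_def]
        exact ENNReal.toReal_mono (Lp.eLpNorm_ne_top _)
          (eLpNorm_le_eLpNorm_of_exponent_le (by norm_num) (Lp.aestronglyMeasurable _))

variable {H : Type*} [NormedAddCommGroup H] [InnerProductSpace ℝ H] [CompleteSpace H]
  {E : Type*} [NormedAddCommGroup E] [NormedSpace ℝ E]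

lemma inner_representer (i : H →L[ℝ] E) (L : StrongDual ℝ E) (h : H) :
    ⟪representer i L, h⟫ = L (i h) := by
  simp [representer, InnerProductSpace.toDual_symm_apply]

/-- `L ↦ iᵀ L` as a linear map. -/
noncomputable def representerₗ (i : H →L[ℝ] E) : StrongDual ℝ E →ₗ[ℝ] H where
  toFun := representer i
  map_add' L L' := by simp [representer, ContinuousLinearMap.add_comp]
  map_smul' c L := by simp [representer, ContinuousLinearMap.smul_comp]

@[simp] lemma representerₗ_apply (i : H →L[ℝ] E) (L : StrongDual ℝ E) :
    representerₗ i L = representer i L := rfl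

/-- Since `i` is injective, `iᵀ` has dense range. -/
lemma denseRange_representerₗ {i : H →L[ℝ] E} (hi : Function.Injective i) :
    DenseRange (representerₗ i) := by
  have h : (LinearMap.range (representerₗ i)).topologicalClosure = ⊤ := by
    rw [Submodule.topologicalClosure_eq_top_iff, Submodule.eq_bot_iff]
    intro x hx
    apply hi
    rw [map_zero]
    refine (SeparatingDual.eq_zero_iff_forall_dual_eq_zero (R := ℝ) _).2 fun L => ?_
    rw [← inner_representer]
    exact (Submodule.mem_orthogonal _ _).1 hx _ ⟨L, rfl⟩
  have h2 := (Submodule.dense_iff_topologicalClosure_eq_top).2 h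
  rwa [LinearMap.coe_range] at h2

variable [MeasurableSpace E]

/-- The Paley–Wiener map: the continuous extension to `H` of `iᵀ L ↦ L`, with values in
`L²(ν)`. It is meaningful when `i` is injective and `ν = N(0, I)`, so that the domain is dense and
the map isometric. -/
noncomputable def wienerMap (i : H →L[ℝ] E) (ν : Measure E) : H →L[ℝ] Lp ℝ 2 ν :=
  (StrongDual.toLpₗ ν 2).extendOfNorm (representerₗ i)

variable {i : H →L[ℝ] E} {ν : Measure E}

lemma wienerMap_sum_smul {ι : Type*} [Fintype ι] (t : ι → ℝ) (h : ι → H) :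
    wienerMap i ν (∑ k, t k • h k) =ᵐ[ν] fun x => ∑ k, t k * wienerMap i ν (h k) x := by
  rw [map_sum]
  have h1 := Lp.coeFn_finsetSum Finset.univ fun k => wienerMap i ν (t k • h k)
  have h2 : ∀ᵐ x ∂ν, ∀ k, wienerMap i ν (t k • h k) x = t k * wienerMap i ν (h k) x := by
    rw [ae_all_iff]
    intro k
    rw [map_smul]
    filter_upwards [Lp.coeFn_smul (t k) (wienerMap i ν (h k))] with x hx
    rw [hx]; rfl
  filter_upwards [h1, h2] with x hx1 hx2
  rw [hx1, Finset.sum_apply]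
  exact Finset.sum_congr rfl fun k _ => hx2 k

lemma measurable_wienerMap (g : H) : Measurable (wienerMap i ν g) :=
  (Lp.stronglyMeasurable _).measurable

variable [BorelSpace E]

lemma IsGaussianWith.variance_eq {ρ : Measure E} {m : H} {S : H →L[ℝ] H}
    (h : IsGaussianWith i ρ m S) (L : StrongDual ℝ E) :
    Var[L; ρ] = ⟪representer i L, S (representer i L)⟫ := by
  rw [← h.cov_eq L L, covariance_self (by fun_prop)]

variable [CompleteSpace E] [SecondCountableTopology E]

/-- `iᵀ L ↦ L` is an isometry into `L²(ν)`, since `L` is centred with variance `‖iᵀ L‖²`. -/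
lemma norm_toLpₗ_eq_norm_representer (hν : IsGaussianWith i ν 0 1) (L : StrongDual ℝ E) :
    ‖StrongDual.toLpₗ ν 2 L‖ = ‖representer i L‖ := by
  have := hν.isGaussian
  have hm : MemLp id 2 ν := IsGaussian.memLp_two_id
  have hL : MemLp L 2 ν := IsGaussian.memLp_dual ν L 2 (by simp)
  have h1 := hν.variance_eq L
  rw [variance_eq_sub hL, hν.mean_eq] at h1
  simp only [inner_zero_right, one_apply_eq_self, real_inner_self_eq_norm_sq] at h1
  rw [← sq_eq_sq₀ (norm_nonneg _) (norm_nonneg _), ← h1, ← real_inner_self_eq_norm_sq,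
    StrongDual.toLpₗ_apply hm, L2.inner_def]
  simp only [ne_eq, OfNat.ofNat_ne_zero, not_false_eq_true, zero_pow, sub_zero]
  refine integral_congr_ae ?_
  filter_upwards [hL.coeFn_toLp] with x hx
  rw [hx]
  simp [sq]

lemma wienerMap_representer (hν : IsAbstractWienerSpace i ν) (L : StrongDual ℝ E) :
    wienerMap i ν (representer i L) =ᵐ[ν] L := by
  have := hν.standard.isGaussian
  have hm : MemLp id 2 ν := IsGaussian.memLp_two_id
  have h : wienerMap i ν (representerₗ i L) = StrongDual.toLpₗ ν 2 L :=
    LinearMap.extendOfNorm_eq (denseRange_representerₗ hν.injective)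
      ⟨1, fun L => by
        rw [one_mul, representerₗ_apply, norm_toLpₗ_eq_norm_representer hν.standard]⟩ L
  rw [← representerₗ_apply, h, StrongDual.toLpₗ_apply hm]
  exact MemLp.coeFn_toLp _

/-- `W g` is a centred Gaussian variable of variance `‖g‖²` under `ν`: this holds on the dense set
of representers, and both sides are continuous in `g`. -/
lemma integral_cexp_wienerMap (hν : IsAbstractWienerSpace i ν) (g : H) :
    ∫ x, Complex.exp (wienerMap i ν g x * Complex.I) ∂ν = Complex.exp (-(‖g‖ ^ 2 : ℝ) / 2) := by
  have := hν.standard.isGaussian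
  revert g
  rw [← funext_iff (f := fun g => ∫ x, Complex.exp (wienerMap i ν g x * Complex.I) ∂ν)
    (g := fun g => Complex.exp (-(‖g‖ ^ 2 : ℝ) / 2))]
  refine (denseRange_representerₗ hν.injective).equalizer
    (continuous_integral_cexp_mul_I.comp (wienerMap i ν).continuous) (by fun_prop) ?_
  funext L
  have h1 : charFunDual ν L = _ := IsGaussian.charFunDual_eq L
  rw [integral_complex_ofReal, hν.standard.mean_eq, hν.standard.variance_eq,
    charFunDual_apply] at h1
  simp only [Function.comp_apply, representerₗ_apply]
  rw [integral_congr_ae (g := fun x => Complex.exp (L x * Complex.I)), h1]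
  · simp only [inner_zero_right, one_apply_eq_self, real_inner_self_eq_norm_sq]
    simp [neg_div]
  · filter_upwards [wienerMap_representer hν L] with x hx
    rw [hx]

lemma charFun_map_wienerMap (hν : IsAbstractWienerSpace i ν) (g : H) (t : ℝ) :
    charFun (ν.map (wienerMap i ν g)) t = Complex.exp (-(t ^ 2 * ‖g‖ ^ 2 : ℝ) / 2) := by
  rw [charFun_apply_real, integral_map (measurable_wienerMap g).aemeasurable
    (by fun_prop)]
  have h := integral_cexp_wienerMap hν (t • g)
  rw [norm_smul, mul_pow, Real.norm_eq_abs, sq_abs] at h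
  rw [← h]
  refine integral_congr_ae ?_
  filter_upwards [Lp.coeFn_smul t (wienerMap i ν g)] with x hx
  rw [map_smul, hx]
  simp

lemma map_wienerMap_of_norm_eq_one (hν : IsAbstractWienerSpace i ν) {g : H} (hg : ‖g‖ = 1) :
    ν.map (wienerMap i ν g) = gaussianReal 0 1 := by
  have := hν.standard.isGaussian
  refine Measure.ext_of_charFun (funext fun t => ?_)
  rw [charFun_map_wienerMap hν, charFun_gaussianReal, hg]
  congr 1
  push_cast
  ring

/-- Orthogonal vectors of `H` give independent variables: their joint characteristic function
factors, by Pythagoras. -/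
lemma iIndepFun_wienerMap (hν : IsAbstractWienerSpace i ν) {ι : Type*} [Fintype ι] {h : ι → H}
    (hh : Pairwise fun k l => ⟪h k, h l⟫ = 0) :
    iIndepFun (fun k => (wienerMap i ν (h k) : E → ℝ)) ν := by
  have := hν.standard.isGaussian
  rw [iIndepFun_iff_charFun_pi fun k => (measurable_wienerMap _).aemeasurable]
  intro t
  have hnorm : ‖∑ k, t k • h k‖ ^ 2 = ∑ k, t k ^ 2 * ‖h k‖ ^ 2 := by
    rw [← real_inner_self_eq_norm_sq, sum_inner]
    refine Finset.sum_congr rfl fun k _ => ?_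
    rw [inner_sum, Finset.sum_eq_single k]
    · rw [inner_smul_left, inner_smul_right, real_inner_self_eq_norm_sq]
      simp; ring
    · intro l _ hl
      rw [inner_smul_left, inner_smul_right, hh hl.symm]; simp
    · simp
  simp_rw [charFun_map_wienerMap hν]
  rw [← Complex.exp_sum, charFun_apply, integral_map]
  · have h1 := integral_cexp_wienerMap hν (∑ k, t k • h k)
    rw [hnorm] at h1
    convert h1 using 1
    · refine integral_congr_ae ?_
      filter_upwards [wienerMap_sum_smul (i := i) (ν := ν) (fun k => t k) h] with x hx
      rw [hx]
      simp [PiLp.inner_apply]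
    · congr 1
      push_cast
      rw [neg_div, Finset.sum_div, ← Finset.sum_neg_distrib]
      refine Finset.sum_congr rfl fun k _ => by ring
  · refine AEMeasurable.comp_measurable (g := WithLp.toLp 2) (by fun_prop) ?_
    exact measurable_pi_lambda _ fun k => measurable_wienerMap _
  · fun_prop

end Wiener

/-! ### Gaussian densities with respect to an abstract Wiener measure -/

section Density

/-- The logarithm of the density of `N(c, (1 + l)⁻¹)` with respect to `N(0, 1)` on the
line, for `0 < 1 + l`. -/
noncomputable def logDensity (l c x : ℝ) : ℝ :=
  1 / 2 * Real.log (1 + l) - 1 / 2 * l * x ^ 2 + (1 + l) * c * x - 1 / 2 * (1 + l) * c ^ 2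

@[fun_prop]
lemma measurable_logDensity (l c : ℝ) : Measurable (logDensity l c) := by
  unfold logDensity; fun_prop

lemma gaussianReal_withDensity_logDensity {l : ℝ} (hl : 0 < 1 + l) (c : ℝ) :
    (gaussianReal 0 1).withDensity (fun x => ENNReal.ofReal (Real.exp (logDensity l c x)))
      = gaussianReal c (1 + l)⁻¹.toNNReal := by
  have hv : (1 + l)⁻¹.toNNReal ≠ 0 := by simpa using hl
  rw [gaussianReal_of_var_ne_zero _ one_ne_zero, gaussianReal_of_var_ne_zero _ hv,
    ← withDensity_mul _ (by fun_prop) (by fun_prop)]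
  congr 1
  funext x
  rw [Pi.mul_apply, gaussianPDF, gaussianPDF, ← ENNReal.ofReal_mul (gaussianPDFReal_nonneg _ _ _)]
  congr 1
  rw [gaussianPDFReal, gaussianPDFReal, Real.coe_toNNReal _ (by positivity),
    mul_assoc _ (Real.exp _) (Real.exp _), ← Real.exp_add]
  -- the constant term of `logDensity` is the ratio of the normalizing constants
  have h1 : √(2 * Real.pi * (1 + l)⁻¹)⁻¹ =
      √(2 * Real.pi)⁻¹ * Real.exp (1 / 2 * Real.log (1 + l)) := by
    rw [mul_inv, inv_inv, Real.sqrt_mul (by positivity), mul_comm (1 / 2 : ℝ), Real.exp_mul,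
      Real.exp_log hl, Real.sqrt_eq_rpow (1 + l)]
  have h2 : (√(2 * Real.pi * (1 + l)⁻¹))⁻¹ =
      (√(2 * Real.pi))⁻¹ * Real.exp (1 / 2 * Real.log (1 + l)) := by
    rw [← Real.sqrt_inv, ← Real.sqrt_inv, h1]
  rw [h2, mul_assoc _ (Real.exp _) (Real.exp _), ← Real.exp_add]
  simp only [NNReal.coe_one, mul_one]
  congr 2
  rw [logDensity]
  field_simp
  ring

lemma integral_cexp_mul_exp_logDensity {l : ℝ} (hl : 0 < 1 + l) (c t : ℝ) :
    ∫ x, Complex.exp (t * x * Complex.I) * (Real.exp (logDensity l c x) : ℂ) ∂(gaussianReal 0 1)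
      = Complex.exp (t * c * Complex.I - (1 + l)⁻¹ * t ^ 2 / 2) := by
  have h := charFun_gaussianReal (μ := c) (v := (1 + l)⁻¹.toNNReal) t
  rw [charFun_apply_real, ← gaussianReal_withDensity_logDensity hl,
    integral_withDensity_eq_integral_toReal_smul (by fun_prop) (by simp)] at h
  rw [Real.coe_toNNReal _ (by positivity)] at h
  push_cast at h ⊢
  rw [← h]
  refine integral_congr_ae (ae_of_all _ fun x => ?_)
  simp only [ENNReal.toReal_ofReal (Real.exp_pos _).le, Complex.real_smul, Complex.ofReal_exp]
  ring

variable {H : Type*} [NormedAddCommGroup H] [InnerProductSpace ℝ H] [CompleteSpace H]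
  {E : Type*} [NormedAddCommGroup E] [NormedSpace ℝ E] [MeasurableSpace E]

/-- The logarithm of the density with respect to `ν = N(0, I)` of the Gaussian measure whose
coordinates along the orthonormal family `e` are independent with laws `N(c j, (1 + l j)⁻¹)`, and
which agrees with `ν` in the orthogonal directions. -/
noncomputable def wienerLogDensity (i : H →L[ℝ] E) (ν : Measure E) {ι : Type*} [Fintype ι]
    (e : ι → H) (l c : ι → ℝ) (x : E) : ℝ :=
  ∑ j, logDensity (l j) (c j) (wienerMap i ν (e j) x)

/-- The measure with density `exp (wienerLogDensity i ν e l c)` with respect to `ν`. -/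
noncomputable def wienerDensityMeasure (i : H →L[ℝ] E) (ν : Measure E) {ι : Type*} [Fintype ι]
    (e : ι → H) (l c : ι → ℝ) : Measure E :=
  ν.withDensity fun x => ENNReal.ofReal (Real.exp (wienerLogDensity i ν e l c x))

variable {i : H →L[ℝ] E} {ν : Measure E} {ι : Type*} [Fintype ι] {e : ι → H} {l c : ι → ℝ}

lemma measurable_wienerLogDensity : Measurable (wienerLogDensity i ν e l c) := by
  unfold wienerLogDensity
  exact Finset.measurable_sum _ fun j _ =>
    (measurable_logDensity _ _).comp (measurable_wienerMap _)

variable [CompleteSpace E] [SecondCountableTopology E] [BorelSpace E]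

/-- The variables `W (e j)` and `W g'`, where `g'` is the part of `g` orthogonal to all `e j`, are
independent, so that the integral factors into integrals over the line. -/
lemma integral_cexp_wienerMap_mul_density (hν : IsAbstractWienerSpace i ν) (he : Orthonormal ℝ e)
    (hl : ∀ j, 0 < 1 + l j) (g : H) :
    ∫ x, Complex.exp (wienerMap i ν g x * Complex.I) *
        (Real.exp (wienerLogDensity i ν e l c x) : ℂ) ∂ν
      = Complex.exp ((∑ j, c j * ⟪e j, g⟫ : ℝ) * Complex.I -
          (‖g‖ ^ 2 + ∑ j, ((1 + l j)⁻¹ - 1) * ⟪e j, g⟫ ^ 2 : ℝ) / 2) := by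
  classical
  have := hν.standard.isGaussian
  set g' : H := g - ∑ j, ⟪e j, g⟫ • e j with hg'
  have horth (j : ι) : ⟪e j, g'⟫ = 0 := by
    rw [hg', inner_sub_right, he.inner_right_fintype, sub_self]
  have hsum : g = ∑ j, ⟪e j, g⟫ • e j + g' := by rw [hg']; abel
  have hnorm : ‖g‖ ^ 2 = ∑ j, ⟪e j, g⟫ ^ 2 + ‖g'‖ ^ 2 := by
    have h0 : ⟪∑ j, ⟪e j, g⟫ • e j, g'⟫ = 0 := by
      simp [sum_inner, inner_smul_left, horth]
    have h1 : ‖∑ j, ⟪e j, g⟫ • e j‖ ^ 2 = ∑ j, ⟪e j, g⟫ ^ 2 := by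
      rw [← real_inner_self_eq_norm_sq, he.inner_sum]
      simp [sq]
    have h2 : ‖g‖ ^ 2 = ‖∑ j, ⟪e j, g⟫ • e j + g'‖ ^ 2 := by rw [← hsum]
    rw [h2, norm_add_sq_real, h0, h1]; ring
  -- the index `none` stands for the orthogonal part, `some j` for the direction `e j`
  let h : Option ι → H := fun o => o.elim g' e
  have hh : Pairwise fun k l => ⟪h k, h l⟫ = 0 := by
    rintro (_ | k) (_ | m) hkm
    · exact absurd rfl hkm
    · exact (real_inner_comm _ _).trans (horth m)
    · exact horth k
    · exact he.2 fun hc => hkm (congrArg _ hc)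
  have hind := iIndepFun_wienerMap hν hh
  let F : Option ι → ℝ → ℂ := fun o => o.elim (fun y => Complex.exp (y * Complex.I))
    (fun j y => Complex.exp (⟪e j, g⟫ * y * Complex.I) * (Real.exp (logDensity (l j) (c j) y) : ℂ))
  have hF (o : Option ι) : AEStronglyMeasurable (F o) (ν.map (wienerMap i ν (h o))) := by
    refine Measurable.aestronglyMeasurable ?_
    rcases o with _ | j
    · change Measurable fun y : ℝ => Complex.exp (y * Complex.I)
      fun_prop
    · change Measurable fun y : ℝ => Complex.exp (⟪e j, g⟫ * y * Complex.I) *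
        (Real.exp (logDensity (l j) (c j) y) : ℂ)
      fun_prop
  have hprod := hind.integral_fun_prod_comp (f := F)
    (fun k => (measurable_wienerMap _).aemeasurable) hF
  simp only [Fintype.prod_option] at hprod
  have hone (j : ι) : ∫ x, F (some j) (wienerMap i ν (h (some j)) x) ∂ν =
      Complex.exp (⟪e j, g⟫ * c j * Complex.I - (1 + l j)⁻¹ * ⟪e j, g⟫ ^ 2 / 2) := by
    rw [← integral_cexp_mul_exp_logDensity (hl j), ← map_wienerMap_of_norm_eq_one hν (he.1 j)]
    exact (integral_map (measurable_wienerMap _).aemeasurable (hF (some j))).symm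
  simp only [hone] at hprod
  have hnone : ∫ x, F none (wienerMap i ν (h none) x) ∂ν = Complex.exp (-(‖g'‖ ^ 2 : ℝ) / 2) :=
    integral_cexp_wienerMap hν g'
  rw [hnone, ← Complex.exp_sum, ← Complex.exp_add] at hprod
  convert hprod using 1
  · refine integral_congr_ae ?_
    have hW : wienerMap i ν g = wienerMap i ν (∑ j, ⟪e j, g⟫ • e j) + wienerMap i ν g' := by
      rw [← map_add, ← hsum]
    have h1 := Lp.coeFn_add (wienerMap i ν (∑ j, ⟪e j, g⟫ • e j)) (wienerMap i ν g')
    rw [← hW] at h1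
    filter_upwards [h1, wienerMap_sum_smul (i := i) (ν := ν) (fun j => ⟪e j, g⟫) e] with x hx1 hx2
    rw [hx1, Pi.add_apply, hx2]
    simp only [F, h, Option.elim, wienerLogDensity, Finset.prod_mul_distrib, Real.exp_sum,
      ← Complex.exp_sum, Complex.ofReal_prod, ← mul_assoc, ← Complex.exp_add]
    congr 2
    push_cast
    rw [add_mul, Finset.sum_mul, add_comm]
  · congr 1
    rw [hnorm]
    push_cast
    simp only [Finset.sum_sub_distrib, sub_mul, one_mul, Finset.sum_mul, ← Finset.sum_div]
    have : ∀ j, (c j * ⟪e j, g⟫ * Complex.I : ℂ) = ⟪e j, g⟫ * c j * Complex.I := fun j => by ring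
    simp only [this]
    ring

/-- The case `g = 0` of `integral_cexp_wienerMap_mul_density` says that the density has
integral `1`; the integral of a function that is not integrable would be `0`. -/
lemma integrable_exp_wienerLogDensity (hν : IsAbstractWienerSpace i ν) (he : Orthonormal ℝ e)
    (hl : ∀ j, 0 < 1 + l j) :
    Integrable (fun x => Real.exp (wienerLogDensity i ν e l c x)) ν := by
  have h := integral_cexp_wienerMap_mul_density (c := c) hν he hl 0
  refine Integrable.of_integral_ne_zero fun h0 => ?_
  have h1 : ∫ x, Complex.exp (wienerMap i ν 0 x * Complex.I) *
        (Real.exp (wienerLogDensity i ν e l c x) : ℂ) ∂ν =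
      ∫ x, (Real.exp (wienerLogDensity i ν e l c x) : ℂ) ∂ν := by
    refine integral_congr_ae ?_
    filter_upwards [Lp.coeFn_zero ℝ 2 ν] with x hx
    rw [map_zero, hx]
    simp
  rw [h1, integral_complex_ofReal, h0] at h
  simp at h

lemma isFiniteMeasure_wienerDensityMeasure (hν : IsAbstractWienerSpace i ν)
    (he : Orthonormal ℝ e) (hl : ∀ j, 0 < 1 + l j) :
    IsFiniteMeasure (wienerDensityMeasure i ν e l c) :=
  isFiniteMeasure_withDensity_ofReal (integrable_exp_wienerLogDensity hν he hl).2

lemma integral_cexp_wienerDensityMeasure (hν : IsAbstractWienerSpace i ν) (he : Orthonormal ℝ e)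
    (hl : ∀ j, 0 < 1 + l j) (g : H) :
    ∫ x, Complex.exp (wienerMap i ν g x * Complex.I) ∂(wienerDensityMeasure i ν e l c)
      = Complex.exp ((∑ j, c j * ⟪e j, g⟫ : ℝ) * Complex.I -
          (‖g‖ ^ 2 + ∑ j, ((1 + l j)⁻¹ - 1) * ⟪e j, g⟫ ^ 2 : ℝ) / 2) := by
  rw [wienerDensityMeasure, integral_withDensity_eq_integral_toReal_smul
    (measurable_wienerLogDensity.exp.ennreal_ofReal) (by simp),
    ← integral_cexp_wienerMap_mul_density hν he hl]
  refine integral_congr_ae (ae_of_all _ fun x => ?_)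
  simp only [ENNReal.toReal_ofReal (Real.exp_pos _).le, Complex.real_smul]
  ring

/-- A Gaussian measure whose mean and covariance are those of `wienerDensityMeasure i ν e l c` is
that measure: this is the Cameron–Martin theorem and the equivalence part of the Feldman–Hájek
theorem, for a finite rank perturbation of the identity. -/
lemma IsGaussianWith.eq_wienerDensityMeasure (hν : IsAbstractWienerSpace i ν)
    (he : Orthonormal ℝ e) (hl : ∀ j, 0 < 1 + l j) {q : Measure E} {m : H} {S : H →L[ℝ] H}
    (hq : IsGaussianWith i q m S) (hm : m = ∑ j, c j • e j)
    (hS : ∀ g, ⟪g, S g⟫ = ‖g‖ ^ 2 + ∑ j, ((1 + l j)⁻¹ - 1) * ⟪e j, g⟫ ^ 2) :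
    q = wienerDensityMeasure i ν e l c := by
  have := hq.isGaussian
  have := isFiniteMeasure_wienerDensityMeasure (c := c) hν he hl
  refine Measure.ext_of_charFunDual (funext fun L => ?_)
  rw [IsGaussian.charFunDual_eq, integral_complex_ofReal, hq.mean_eq, hq.variance_eq, hS,
    charFunDual_apply, hm]
  have hac : wienerDensityMeasure i ν e l c ≪ ν := withDensity_absolutelyContinuous _ _
  rw [← integral_congr_ae (f := fun x =>
    Complex.exp (wienerMap i ν (representer i L) x * Complex.I))]
  · rw [integral_cexp_wienerDensityMeasure hν he hl]
    simp [inner_sum, inner_smul_right, real_inner_comm (representer i L)]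
  · filter_upwards [hac.ae_le (wienerMap_representer hν L)] with x hx
    rw [hx]

/-- The law of `W g` under a Gaussian measure that is absolutely continuous with respect to `ν`: the
mean and covariance, given on representers only, extend to all of `H`. -/
lemma map_wienerMap_wienerDensityMeasure (hν : IsAbstractWienerSpace i ν)
    (he : Orthonormal ℝ e) (hl : ∀ j, 0 < 1 + l j) {m : H} {S : H →L[ℝ] H}
    (hm : m = ∑ j, c j • e j)
    (hS : ∀ g, ⟪g, S g⟫ = ‖g‖ ^ 2 + ∑ j, ((1 + l j)⁻¹ - 1) * ⟪e j, g⟫ ^ 2)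
    (hS0 : ∀ g, 0 ≤ ⟪g, S g⟫) (g : H) :
    (wienerDensityMeasure i ν e l c).map (wienerMap i ν g)
      = gaussianReal ⟪g, m⟫ ⟪g, S g⟫.toNNReal := by
  have := isFiniteMeasure_wienerDensityMeasure (c := c) hν he hl
  refine Measure.ext_of_charFun (funext fun t => ?_)
  rw [charFun_gaussianReal, charFun_apply_real, integral_map (measurable_wienerMap g).aemeasurable
    (by fun_prop), Real.coe_toNNReal _ (hS0 g)]
  have h := integral_cexp_wienerDensityMeasure (c := c) hν he hl (t • g)
  rw [← hS] at h
  have hac : wienerDensityMeasure i ν e l c ≪ ν := withDensity_absolutelyContinuous _ _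
  rw [integral_congr_ae (g := fun x => Complex.exp (wienerMap i ν (t • g) x * Complex.I)), h]
  · congr 1
    rw [hm]
    simp only [map_smul, inner_smul_left, inner_smul_right, inner_sum]
    push_cast
    simp only [Finset.sum_mul, Finset.mul_sum, real_inner_comm g]
    congr 1
    · exact Finset.sum_congr rfl fun j _ => by simp; ring
    · simp; ring
  · filter_upwards [hac.ae_le (Lp.coeFn_smul t (wienerMap i ν g))] with x hx
    rw [map_smul, hx]
    simp

end Density

/-! ### Finite rank perturbations of the identity -/

section FiniteRank

variable {H : Type*} [NormedAddCommGroup H] [InnerProductSpace ℝ H]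
  {ι κ μ : Type*} [Fintype ι] [Fintype κ] [Fintype μ]

lemma synthesis_apply (ψ : ι → H) (a : EuclideanSpace ℝ ι) : synthesis ψ a = ∑ k, a k • ψ k := by
  simp [synthesis]

lemma kernelMatrix_transpose {ι κ : Type*} (φ : ι → H) (ψ : κ → H) :
    (kernelMatrix φ ψ)ᵀ = kernelMatrix ψ φ := by
  ext k j
  simp [kernelMatrix, real_inner_comm]

lemma kernelMatrix_mul_mul_apply {ι μ : Type*} (φ : ι → H) (ψ : κ → H) (χ : μ → H)
    (B : Matrix κ κ ℝ) (j : ι) (m : μ) :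
    (kernelMatrix φ ψ * B * kernelMatrix ψ χ) j m
      = (fun k => ⟪ψ k, φ j⟫) ⬝ᵥ B *ᵥ (fun k => ⟪ψ k, χ m⟫) := by
  rw [Matrix.mul_assoc, Matrix.mul_apply, dotProduct]
  refine Finset.sum_congr rfl fun k _ => ?_
  rw [Matrix.mul_apply, Matrix.mulVec, dotProduct]
  simp [kernelMatrix, real_inner_comm (φ j)]

lemma kernelMatrix_mulVec {ι : Type*} (φ : ι → H) (ψ : κ → H) (b : κ → ℝ) (j : ι) :
    (kernelMatrix φ ψ *ᵥ b) j = ⟪φ j, synthesis ψ (WithLp.toLp 2 b)⟫ := by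
  simp [kernelMatrix, Matrix.mulVec, dotProduct, synthesis_apply, inner_sum, inner_smul_right,
    mul_comm]

lemma inner_synthesis_synthesis (φ : ι → H) (ψ : κ → H) (a : ι → ℝ) (b : κ → ℝ) :
    ⟪synthesis φ (WithLp.toLp 2 a), synthesis ψ (WithLp.toLp 2 b)⟫
      = a ⬝ᵥ kernelMatrix φ ψ *ᵥ b := by
  simp only [dotProduct, kernelMatrix_mulVec, synthesis_apply φ, sum_inner, inner_smul_left]
  simp

variable [CompleteSpace H]

lemma adjoint_synthesis_apply (ψ : ι → H) (x : H) :
    (synthesis ψ).adjoint x = WithLp.toLp 2 fun k => ⟪ψ k, x⟫ := by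
  classical
  refine ext_inner_left ℝ fun a => ?_
  rw [ContinuousLinearMap.adjoint_inner_right, synthesis_apply, sum_inner]
  simp [PiLp.inner_apply, inner_smul_left, mul_comm]

variable [DecidableEq κ]

lemma precision_apply (ψ : κ → H) (B : Matrix κ κ ℝ) (x : H) :
    precision ψ B x = x + synthesis ψ (WithLp.toLp 2 (B *ᵥ fun k => ⟪ψ k, x⟫)) := by
  rw [precision, add_apply, one_apply_eq_self, ContinuousLinearMap.comp_apply,
    ContinuousLinearMap.comp_apply, adjoint_synthesis_apply, Matrix.toEuclideanCLM_toLp]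

lemma inner_precision (ψ : κ → H) (B : Matrix κ κ ℝ) (x y : H) :
    ⟪x, precision ψ B y⟫ = ⟪x, y⟫ + (fun k => ⟪ψ k, x⟫) ⬝ᵥ B *ᵥ fun k => ⟪ψ k, y⟫ := by
  rw [precision_apply, inner_add_right, synthesis_apply, inner_sum]
  simp only [inner_smul_right, dotProduct, real_inner_comm x]
  simp [mul_comm]

lemma inner_precision_comm (ψ : κ → H) {B : Matrix κ κ ℝ} (hB : B.IsSymm) (x y : H) :
    ⟪precision ψ B x, y⟫ = ⟪x, precision ψ B y⟫ := by
  rw [real_inner_comm, inner_precision, inner_precision, real_inner_comm x,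
    Matrix.dotProduct_mulVec, ← Matrix.mulVec_transpose, hB.eq, dotProduct_comm]

lemma inner_synthesis_precision_synthesis (φ : ι → H) (ψ : κ → H) (χ : μ → H)
    (B : Matrix κ κ ℝ) (a : ι → ℝ) (b : μ → ℝ) :
    ⟪synthesis φ (WithLp.toLp 2 a), precision ψ B (synthesis χ (WithLp.toLp 2 b))⟫
      = a ⬝ᵥ (kernelMatrix φ χ + kernelMatrix φ ψ * B * kernelMatrix ψ χ) *ᵥ b := by
  rw [precision_apply, inner_add_right, inner_synthesis_synthesis, inner_synthesis_synthesis,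
    Matrix.add_mulVec, dotProduct_add]
  congr 2
  rw [← Matrix.mulVec_mulVec, ← Matrix.mulVec_mulVec]
  congr 2
  funext k
  rw [kernelMatrix_mulVec]

/-- Operators of the form `I + Ψ B Ψᵀ` are closed under composition, because `Ψᵀ Ψ = K`. -/
lemma precision_mul_precision (ψ : κ → H) (B C : Matrix κ κ ℝ) :
    precision ψ B * precision ψ C = precision ψ (B + C + B * kernelMatrix ψ ψ * C) := by
  ext x
  rw [mul_apply_eq_comp, precision_apply ψ B]
  have h : (fun k => ⟪ψ k, precision ψ C x⟫)
      = (fun k => ⟪ψ k, x⟫) + kernelMatrix ψ ψ *ᵥ (C *ᵥ fun k => ⟪ψ k, x⟫) := by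
    funext k
    rw [Pi.add_apply, kernelMatrix_mulVec, precision_apply, inner_add_right]
  rw [h, precision_apply, precision_apply, Matrix.add_mulVec, Matrix.add_mulVec, Matrix.mulVec_add]
  simp only [WithLp.toLp_add, map_add, Matrix.mulVec_mulVec, Matrix.mul_assoc]
  abel

lemma precision_zero (ψ : κ → H) : precision ψ (0 : Matrix κ κ ℝ) = 1 := by
  ext x
  rw [precision_apply]
  simp

/-- The Woodbury identity `(I + Ψ B Ψᵀ)⁻¹ = I - Ψ B (I + K B)⁻¹ Ψᵀ`. -/
lemma inverse_precision (ψ : κ → H) {B : Matrix κ κ ℝ} (hu : IsUnit (precision ψ B))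
    (hdet : IsUnit (1 + kernelMatrix ψ ψ * B).det) :
    Ring.inverse (precision ψ B) =
      precision ψ (-(B * (1 + kernelMatrix ψ ψ * B)⁻¹)) := by
  have h : precision ψ B * precision ψ (-(B * (1 + kernelMatrix ψ ψ * B)⁻¹)) = 1 := by
    rw [precision_mul_precision, ← precision_zero ψ]
    congr 1
    have h1 : B * (1 + kernelMatrix ψ ψ * B) * (1 + kernelMatrix ψ ψ * B)⁻¹ = B := by
      rw [mul_assoc, Matrix.mul_nonsing_inv _ hdet, mul_one]
    nth_rewrite 1 [← h1]
    noncomm_ring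
  calc Ring.inverse (precision ψ B)
      = Ring.inverse (precision ψ B) *
        (precision ψ B * precision ψ (-(B * (1 + kernelMatrix ψ ψ * B)⁻¹))) := by rw [h, mul_one]
    _ = _ := by rw [← mul_assoc, Ring.inverse_mul_cancel _ hu, one_mul]

/-- The orthonormal family `e` spans a space that contains the family `ψ`, and `I + Ψ B Ψᵀ` is
diagonal along it with eigenvalues `1 + l j`. -/
structure IsDiagonalization (e : ι → H) (l : ι → ℝ) (ψ : κ → H) (B : Matrix κ κ ℝ) : Prop where
  orthonormal : Orthonormal ℝ e
  precision_apply : ∀ x, precision ψ B x = x + ∑ j, (l j * ⟪e j, x⟫) • e j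
  family_eq : ∀ k, ψ k = ∑ j, ⟪e j, ψ k⟫ • e j

/-- The spectral theorem for `Ψ B Ψᵀ` on the span of `ψ` and `m`. -/
lemma exists_isDiagonalization (ψ : κ → H) {B : Matrix κ κ ℝ} (hB : B.IsSymm) (m : H) :
    ∃ (n : ℕ) (e : Fin n → H) (l c : Fin n → ℝ),
      IsDiagonalization e l ψ B ∧ m = ∑ j, c j • e j := by
  let V : Submodule ℝ H := Submodule.span ℝ (insert m (Set.range ψ))
  have : FiniteDimensional ℝ V :=
    FiniteDimensional.span_of_finite ℝ ((Set.finite_range ψ).insert m)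
  have hψ (k : κ) : ψ k ∈ V := Submodule.subset_span (Or.inr ⟨k, rfl⟩)
  have hT (x : H) : precision ψ B x - x ∈ V := by
    rw [precision_apply, add_sub_cancel_left, synthesis_apply]
    exact Submodule.sum_mem _ fun k _ => V.smul_mem _ (hψ k)
  let T : V →ₗ[ℝ] V := ((precision ψ B - 1 : H →L[ℝ] H) : H →ₗ[ℝ] H).restrict fun x _ => hT x
  have hTsymm : T.IsSymmetric := by
    intro x y
    change ⟪precision ψ B x - x, (y : H)⟫ = ⟪(x : H), precision ψ B y - y⟫
    rw [inner_sub_left, inner_sub_right, inner_precision_comm ψ hB]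
  let b := hTsymm.eigenvectorBasis (n := Module.finrank ℝ V) rfl
  let l := hTsymm.eigenvalues (n := Module.finrank ℝ V) rfl
  have hexp (v : V) : (v : H) = ∑ j, ⟪(b j : H), v⟫ • (b j : H) := by
    conv_lhs => rw [← b.sum_repr' v]
    simp
  refine ⟨_, fun j => b j, l, fun j => ⟪(b j : H), m⟫, ⟨?_, fun x => ?_, fun k => ?_⟩, ?_⟩
  · exact b.orthonormal.comp_linearIsometry V.subtypeₗᵢ
  · rw [← sub_eq_iff_eq_add']
    refine (hexp ⟨_, hT x⟩).trans ?_
    refine Finset.sum_congr rfl fun j _ => ?_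
    have h1 : precision ψ B (b j) - b j = l j • (b j : H) :=
      congrArg Subtype.val (hTsymm.apply_eigenvectorBasis rfl j)
    congr 1
    rw [inner_sub_right, ← inner_precision_comm ψ hB, ← inner_sub_left, h1, inner_smul_left]
    simp
  · exact hexp ⟨ψ k, hψ k⟩
  · exact hexp ⟨m, Submodule.subset_span (Or.inl rfl)⟩

variable {e : ι → H} {l : ι → ℝ} {ψ : κ → H} {B : Matrix κ κ ℝ}

lemma IsDiagonalization.inner_precision_apply (h : IsDiagonalization e l ψ B) (j : ι) (x : H) :
    ⟪e j, precision ψ B x⟫ = (1 + l j) * ⟪e j, x⟫ := by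
  rw [h.precision_apply, inner_add_right, h.orthonormal.inner_right_fintype]
  ring

lemma IsDiagonalization.mulVec_inner (h : IsDiagonalization e l ψ B) (x y : H) :
    (fun k => ⟪ψ k, x⟫) ⬝ᵥ B *ᵥ (fun k => ⟪ψ k, y⟫) = ∑ j, l j * ⟪e j, x⟫ * ⟪e j, y⟫ := by
  have h1 := inner_precision ψ B x y
  rw [h.precision_apply, inner_add_right, add_right_inj, inner_sum] at h1
  rw [← h1]
  refine Finset.sum_congr rfl fun j _ => ?_
  rw [inner_smul_right, real_inner_comm x]
  ring

lemma IsDiagonalization.kernelMatrix_eq {μ : Type*} (h : IsDiagonalization e l ψ B) (χ : μ → H) :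
    kernelMatrix ψ χ = kernelMatrix ψ e * kernelMatrix e χ := by
  ext k m
  rw [Matrix.mul_apply]
  simp only [kernelMatrix, Matrix.of_apply]
  conv_lhs => rw [h.family_eq k, sum_inner]
  simp [inner_smul_left, real_inner_comm (ψ k)]

lemma IsDiagonalization.kernelMatrix_mul_mul [DecidableEq ι] (h : IsDiagonalization e l ψ B) :
    kernelMatrix e ψ * B * kernelMatrix ψ e = Matrix.diagonal l := by
  ext j m
  rw [kernelMatrix_mul_mul_apply, h.mulVec_inner, Matrix.diagonal_apply]
  simp only [orthonormal_iff_ite.1 h.orthonormal]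
  by_cases hjm : j = m
  · simp [hjm]
  · simp [hjm, Ne.symm hjm]

/-- Since `K = K_{ψ,e} K_{e,ψ}` and `K_{e,ψ} B K_{ψ,e} = diag l`, this is Sylvester's determinant
identity. -/
lemma IsDiagonalization.det_eq (h : IsDiagonalization e l ψ B) :
    (1 + kernelMatrix ψ ψ * B).det = ∏ j, (1 + l j) := by
  classical
  rw [h.kernelMatrix_eq, Matrix.mul_assoc, Matrix.det_one_add_mul_comm, h.kernelMatrix_mul_mul,
    ← Matrix.diagonal_one, Matrix.diagonal_add, Matrix.det_diagonal]

/-- The trace of `Ψ B Ψᵀ (I + Ψ_χ C Ψ_χᵀ)`, computed in the eigenbasis on the left and through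
kernel matrices on the right. -/
lemma IsDiagonalization.sum_mul_inner_precision [DecidableEq μ]
    (h : IsDiagonalization e l ψ B) (χ : μ → H) (C : Matrix μ μ ℝ) :
    ∑ j, l j * ⟪e j, precision χ C (e j)⟫ = (kernelMatrix ψ ψ * B).trace +
      (kernelMatrix χ ψ * B * kernelMatrix ψ χ * C).trace := by
  classical
  have h1 : kernelMatrix χ ψ = kernelMatrix χ e * kernelMatrix e ψ := by
    rw [← kernelMatrix_transpose ψ χ, h.kernelMatrix_eq, Matrix.transpose_mul,
      kernelMatrix_transpose, kernelMatrix_transpose]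
  have h2 : kernelMatrix χ ψ * B * kernelMatrix ψ χ * C =
      kernelMatrix χ e * (Matrix.diagonal l * (kernelMatrix e χ * C)) := by
    rw [← h.kernelMatrix_mul_mul, h1, h.kernelMatrix_eq]
    simp only [Matrix.mul_assoc]
  have h3 : (kernelMatrix ψ ψ * B).trace = (Matrix.diagonal l).trace := by
    rw [h.kernelMatrix_eq, Matrix.mul_assoc, Matrix.trace_mul_comm, h.kernelMatrix_mul_mul]
  rw [h2, h3, Matrix.trace_mul_comm, Matrix.mul_assoc, Matrix.trace, Matrix.trace,
    ← Finset.sum_add_distrib]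
  refine Finset.sum_congr rfl fun j _ => ?_
  rw [Matrix.diag_apply, Matrix.diag_apply, Matrix.diagonal_mul, kernelMatrix_mul_mul_apply,
    inner_precision, real_inner_self_eq_norm_sq, h.orthonormal.1 j, Matrix.diagonal_apply_eq]
  ring

end FiniteRank

/-! ### Divergence between exponential densities and moments of log-densities -/

/-- The divergence between two probability measures with positive densities `exp f` and `exp g` with
respect to a common measure. -/
lemma klDiv_withDensity_exp {Ω : Type*} [MeasurableSpace Ω] {ν q p : Measure Ω} {f g : Ω → ℝ}
    [SigmaFinite ν] [IsProbabilityMeasure q] [IsProbabilityMeasure p]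
    (hf : Measurable f) (hg : Measurable g)
    (hq : q = ν.withDensity fun x => ENNReal.ofReal (Real.exp (f x)))
    (hp : p = ν.withDensity fun x => ENNReal.ofReal (Real.exp (g x)))
    (hfi : Integrable f q) (hgi : Integrable g q) :
    klDiv q p ≠ ∞ ∧ (klDiv q p).toReal = ∫ x, f x ∂q - ∫ x, g x ∂q := by
  have hqp : q = p.withDensity fun x => ENNReal.ofReal (Real.exp (f x - g x)) := by
    rw [hp, ← withDensity_mul _ (by fun_prop) (by fun_prop), hq]
    congr 1
    funext x
    rw [Pi.mul_apply, ← ENNReal.ofReal_mul (Real.exp_pos _).le, ← Real.exp_add,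
      add_sub_cancel]
  have hac : q ≪ p := by
    rw [hqp]; exact withDensity_absolutelyContinuous _ _
  have hllr : llr q p =ᵐ[q] fun x => f x - g x := by
    have h1 : q.rnDeriv p =ᵐ[p] fun x => ENNReal.ofReal (Real.exp (f x - g x)) := by
      conv_lhs => rw [hqp]
      exact Measure.rnDeriv_withDensity p (by fun_prop)
    filter_upwards [hac.ae_le h1] with x hx
    rw [llr_def]
    simp only [hx, ENNReal.toReal_ofReal (Real.exp_pos _).le, Real.log_exp]
  have hint : Integrable (llr q p) q := (hfi.sub hgi).congr hllr.symm
  refine ⟨klDiv_ne_top hac hint, ?_⟩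
  rw [toReal_klDiv_of_measure_eq hac (by simp), integral_congr_ae hllr, integral_sub hfi hgi]

section Expectation

variable {H : Type*} [NormedAddCommGroup H] [InnerProductSpace ℝ H] [CompleteSpace H]
  {E : Type*} [NormedAddCommGroup E] [NormedSpace ℝ E] [MeasurableSpace E]
  {i : H →L[ℝ] E} {ν : Measure E} {ι κ : Type*} [Fintype ι] [Fintype κ] [DecidableEq κ]

/-- If every `W g` is Gaussian under `q`, with mean `⟪g, m⟫` and variance `⟪g, S g⟫`, then a
logarithmic density, being a quadratic polynomial in such variables, has this integral under `q`. -/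
lemma integral_wienerLogDensity {q : Measure E} {m : H} {S : H →L[ℝ] H}
    (hS0 : ∀ g, 0 ≤ ⟪g, S g⟫)
    (hq : ∀ g, q.map (wienerMap i ν g) = gaussianReal ⟪g, m⟫ ⟪g, S g⟫.toNNReal)
    (e : ι → H) (l c : ι → ℝ) :
    Integrable (wienerLogDensity i ν e l c) q ∧
      ∫ x, wienerLogDensity i ν e l c x ∂q =
        ∑ j, (1 / 2 * Real.log (1 + l j) - 1 / 2 * l j * (⟪e j, S (e j)⟫ + ⟪e j, m⟫ ^ 2)
          + (1 + l j) * c j * ⟪e j, m⟫ - 1 / 2 * (1 + l j) * c j ^ 2) := by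
  have hreal (l c a : ℝ) (v : NNReal) : Integrable (logDensity l c) (gaussianReal a v) ∧
      ∫ y, logDensity l c y ∂(gaussianReal a v) =
        1 / 2 * Real.log (1 + l) - 1 / 2 * l * (v + a ^ 2) + (1 + l) * c * a
          - 1 / 2 * (1 + l) * c ^ 2 := by
    have hm : MemLp (fun y : ℝ => y) 2 (gaussianReal a v) := memLp_id_gaussianReal 2
    have h1 : Integrable (fun y : ℝ => y) (gaussianReal a v) := hm.integrable (by norm_num)
    have h2 : Integrable (fun y : ℝ => y ^ 2) (gaussianReal a v) := hm.integrable_sq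
    have hvar := variance_eq_sub hm
    rw [variance_fun_id_gaussianReal, integral_id_gaussianReal] at hvar
    simp only [Pi.pow_apply] at hvar
    have i1 : Integrable (fun _ : ℝ => 1 / 2 * Real.log (1 + l)) (gaussianReal a v) :=
      integrable_const _
    have i2 := h2.const_mul (1 / 2 * l)
    have i3 := h1.const_mul ((1 + l) * c)
    have i4 : Integrable (fun _ : ℝ => 1 / 2 * (1 + l) * c ^ 2) (gaussianReal a v) :=
      integrable_const _
    have i12 : Integrable (fun y : ℝ => 1 / 2 * Real.log (1 + l) - 1 / 2 * l * y ^ 2)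
        (gaussianReal a v) := i1.sub i2
    have i13 : Integrable (fun y : ℝ => 1 / 2 * Real.log (1 + l) - 1 / 2 * l * y ^ 2
        + (1 + l) * c * y) (gaussianReal a v) := i12.add i3
    refine ⟨i13.sub i4, ?_⟩
    simp only [logDensity]
    rw [integral_sub i13 i4, integral_add i12 i3, integral_sub i1 i2,
      integral_const_mul ((1 + l) * c) fun y : ℝ => y, integral_id_gaussianReal]
    simp only [integral_const_mul, integral_const, probReal_univ, one_smul]
    linear_combination (1 / 2 * l) * hvar
  have hj (j : ι) : Integrable (fun x => logDensity (l j) (c j) (wienerMap i ν (e j) x)) q := by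
    have h := (hreal (l j) (c j) ⟪e j, m⟫ ⟪e j, S (e j)⟫.toNNReal).1
    rw [← hq] at h
    exact h.comp_measurable (measurable_wienerMap _)
  refine ⟨integrable_finsetSum _ fun j _ => hj j, ?_⟩
  simp only [wienerLogDensity]
  rw [integral_finsetSum _ fun j _ => hj j]
  refine Finset.sum_congr rfl fun j _ => ?_
  have h := (hreal (l j) (c j) ⟪e j, m⟫ ⟪e j, S (e j)⟫.toNNReal).2
  rw [← hq, integral_map (measurable_wienerMap _).aemeasurable
    (measurable_logDensity _ _).aestronglyMeasurable, Real.coe_toNNReal _ (hS0 _)] at h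
  exact h

/-- The integral of a logarithmic density, in terms of the operators instead of their spectral
data. -/
lemma IsDiagonalization.sum_logDensity_moments_eq {e : ι → H} {l c : ι → ℝ}
    {ψ : κ → H} {B : Matrix κ κ ℝ}
    (h : IsDiagonalization e l ψ B) (hl : ∀ j, 0 < 1 + l j) {μ : Type*} [Fintype μ]
    [DecidableEq μ] (χ : μ → H) (C : Matrix μ μ ℝ) (m m' : H) (hm' : m' = ∑ j, c j • e j) :
    ∑ j, (1 / 2 * Real.log (1 + l j)
        - 1 / 2 * l j * (⟪e j, precision χ C (e j)⟫ + ⟪e j, m⟫ ^ 2)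
        + (1 + l j) * c j * ⟪e j, m⟫ - 1 / 2 * (1 + l j) * c j ^ 2)
      = 1 / 2 * Real.log (1 + kernelMatrix ψ ψ * B).det
        - 1 / 2 * ((kernelMatrix ψ ψ * B).trace +
            (kernelMatrix χ ψ * B * kernelMatrix ψ χ * C).trace)
        - 1 / 2 * (⟪m, precision ψ B m⟫ - ⟪m, m⟫) + ⟪m, precision ψ B m'⟫
        - 1 / 2 * ⟪m', precision ψ B m'⟫ := by
  have hc (j : ι) : ⟪e j, m'⟫ = c j := by rw [hm', h.orthonormal.inner_right_fintype]
  have h1 (x : H) : ⟪x, precision ψ B m'⟫ = ∑ j, (1 + l j) * c j * ⟪e j, x⟫ := by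
    have hP : precision ψ B m' = ∑ j, ((1 + l j) * c j) • e j := by
      rw [h.precision_apply]
      nth_rewrite 1 [hm']
      rw [← Finset.sum_add_distrib]
      exact Finset.sum_congr rfl fun j _ => by rw [hc, ← add_smul]; ring_nf
    rw [hP, inner_sum]
    exact Finset.sum_congr rfl fun j _ => by rw [inner_smul_right, real_inner_comm]
  have h2 : ⟪m, precision ψ B m⟫ - ⟪m, m⟫ = ∑ j, l j * ⟪e j, m⟫ ^ 2 := by
    rw [h.precision_apply, inner_add_right, add_sub_cancel_left, inner_sum]
    exact Finset.sum_congr rfl fun j _ => by rw [inner_smul_right, real_inner_comm]; ring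
  rw [h2, h1, h1, h.det_eq, Real.log_prod fun j _ => (hl j).ne', ← h.sum_mul_inner_precision]
  simp only [hc, Finset.mul_sum, ← Finset.sum_add_distrib, ← Finset.sum_sub_distrib]
  exact Finset.sum_congr rfl fun j _ => by ring

variable [BorelSpace E]

/-- A covariance operator is nonnegative, since the representers of functionals are dense. -/
lemma IsGaussianWith.inner_nonneg (hi : Function.Injective i) {q : Measure E} {m : H}
    {S : H →L[ℝ] H} (hq : IsGaussianWith i q m S) (g : H) : 0 ≤ ⟪g, S g⟫ := by
  refine (denseRange_representerₗ hi).induction_on (p := fun g => 0 ≤ ⟪g, S g⟫) g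
    (isClosed_le (by fun_prop) (by fun_prop)) fun L => ?_
  rw [representerₗ_apply, ← hq.variance_eq]
  exact variance_nonneg _ _

/-- `(1 + l j)⁻¹ = ⟪e j, S (e j)⟫` is a limit of variances, so a nonnegative number. -/
lemma IsSubspaceGaussian.one_add_pos (hi : Function.Injective i) {ια : Type*} [Fintype ια]
    {q : Measure E} {α : ια → H} {a : ια → ℝ} {β : κ → H} {B : Matrix κ κ ℝ}
    (hq : IsSubspaceGaussian i q α a β B) {e : ι → H} {l : ι → ℝ}
    (h : IsDiagonalization e l β B) (j : ι) : 0 < 1 + l j := by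
  have h0 := hq.gaussian.inner_nonneg hi (e j)
  have h1 : precision β B (Ring.inverse (precision β B) (e j)) = e j := by
    rw [← mul_apply_eq_comp, Ring.mul_inverse_cancel _ hq.isUnit, one_apply_eq_self]
  have h2 := h.inner_precision_apply j (Ring.inverse (precision β B) (e j))
  rw [h1, real_inner_self_eq_norm_sq, h.orthonormal.1 j] at h2
  by_contra hneg
  nlinarith

lemma IsSubspaceGaussian.det_pos {ια : Type*} [Fintype ια] (hi : Function.Injective i)
    {q : Measure E} {α : ια → H} {a : ια → ℝ} {β : κ → H} {B : Matrix κ κ ℝ} (hB : B.IsSymm)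
    (hq : IsSubspaceGaussian i q α a β B) : 0 < (1 + kernelMatrix β β * B).det := by
  obtain ⟨n, e, l, c, h, -⟩ := exists_isDiagonalization β hB 0
  rw [h.det_eq]
  exact Finset.prod_pos fun j _ => hq.one_add_pos hi h j

lemma IsDiagonalization.inner_inverse {β : κ → H} {B : Matrix κ κ ℝ} {e : ι → H} {l : ι → ℝ}
    (h : IsDiagonalization e l β B) (hl : ∀ j, 0 < 1 + l j) (hu : IsUnit (precision β B)) (g : H) :
    ⟪g, Ring.inverse (precision β B) g⟫
      = ‖g‖ ^ 2 + ∑ j, ((1 + l j)⁻¹ - 1) * ⟪e j, g⟫ ^ 2 := by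
  set r := Ring.inverse (precision β B) g with hr
  have hg : precision β B r = g := by
    rw [hr, ← mul_apply_eq_comp, Ring.mul_inverse_cancel _ hu, one_apply_eq_self]
  have h1 (j : ι) : ⟪e j, g⟫ = (1 + l j) * ⟪e j, r⟫ := by
    rw [← h.inner_precision_apply, hg]
  have h2 : r = g - ∑ j, (l j * ⟪e j, r⟫) • e j := by
    rw [eq_sub_iff_add_eq, ← h.precision_apply, hg]
  conv_lhs => rw [h2, inner_sub_right, real_inner_self_eq_norm_sq, inner_sum]
  rw [sub_eq_add_neg, ← Finset.sum_neg_distrib]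
  congr 1
  refine Finset.sum_congr rfl fun j _ => ?_
  rw [inner_smul_right, real_inner_comm (e j) g, h1]
  have := (hl j).ne'
  field_simp
  ring

end Expectation

/-! ### The divergence formula -/

section Divergence

variable {H : Type*} [NormedAddCommGroup H] [InnerProductSpace ℝ H] [CompleteSpace H]
  {E : Type*} [NormedAddCommGroup E] [NormedSpace ℝ E] [CompleteSpace E]
  [SecondCountableTopology E] [MeasurableSpace E] [BorelSpace E]
  {i : H →L[ℝ] E} {ν : Measure E}
  {ια ιβ ια' ιβ' : Type*} [Fintype ια] [Fintype ιβ] [Fintype ια'] [Fintype ιβ']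
  [DecidableEq ιβ] [DecidableEq ιβ']
  {q : Measure E} {α : ια → H} {a : ια → ℝ} {β : ιβ → H} {B : Matrix ιβ ιβ ℝ}
  {p : Measure E} {α' : ια' → H} {a' : ια' → ℝ} {β' : ιβ' → H} {B' : Matrix ιβ' ιβ' ℝ}

/-- The logarithmic densities of `q` and `p` with respect to `ν` are quadratic polynomials in
finitely many variables `W g`, whose first two moments under `q` are known. -/
lemma klDiv_isSubspaceGaussian (hν : IsAbstractWienerSpace i ν)
    (hB : B.IsSymm) (hq : IsSubspaceGaussian i q α a β B)
    (hB' : B'.IsSymm) (hp : IsSubspaceGaussian i p α' a' β' B') :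
    klDiv q p ≠ ∞ ∧
      (klDiv q p).toReal =
        -(1 / 2) * ((kernelMatrix β β + kernelMatrix β β' * B' * kernelMatrix β' β) *
            (B * (1 + kernelMatrix β β * B)⁻¹)).trace
          + 1 / 2 * Real.log (1 + kernelMatrix β β * B).det
          + 1 / 2 * (a ⬝ᵥ (kernelMatrix α α + kernelMatrix α β' * B' * kernelMatrix β' α) *ᵥ a)
          - a ⬝ᵥ (kernelMatrix α α' + kernelMatrix α β' * B' * kernelMatrix β' α') *ᵥ a'
          + 1 / 2 * ((kernelMatrix β' β' * B').trace
            - Real.log (1 + kernelMatrix β' β' * B').det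
            + a' ⬝ᵥ (kernelMatrix α' α' + kernelMatrix α' β' * B' * kernelMatrix β' α') *ᵥ a') := by
  have := hν.standard.isGaussian
  have := hq.gaussian.isGaussian
  have := hp.gaussian.isGaussian
  obtain ⟨n, e, l, c, h, hm⟩ :=
    exists_isDiagonalization β hB (synthesis α (WithLp.toLp 2 a))
  obtain ⟨n', e', l', c', h', hm'⟩ :=
    exists_isDiagonalization β' hB' (synthesis α' (WithLp.toLp 2 a'))
  have hl := fun j => hq.one_add_pos hν.injective h j
  have hl' := fun j => hp.one_add_pos hν.injective h' j
  have hS := h.inner_inverse hl hq.isUnit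
  have hS0 := fun g => hq.gaussian.inner_nonneg hν.injective g
  have hq' := hq.gaussian.eq_wienerDensityMeasure hν h.orthonormal hl hm hS
  have hp' := hp.gaussian.eq_wienerDensityMeasure hν h'.orthonormal hl' hm'
    (h'.inner_inverse hl' hp.isUnit)
  have hmap := map_wienerMap_wienerDensityMeasure hν h.orthonormal hl hm hS hS0
  rw [← hq'] at hmap
  have hdet : IsUnit (1 + kernelMatrix β β * B).det :=
    (hq.det_pos hν.injective hB).ne'.isUnit
  set G := B * (1 + kernelMatrix β β * B)⁻¹ with hG
  rw [inverse_precision β hq.isUnit hdet, ← hG] at hmap hS0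
  obtain ⟨i1, v1⟩ := integral_wienerLogDensity hS0 hmap e l c
  obtain ⟨i2, v2⟩ := integral_wienerLogDensity hS0 hmap e' l' c'
  obtain ⟨hfin, hval⟩ := klDiv_withDensity_exp measurable_wienerLogDensity
    measurable_wienerLogDensity hq' hp' i1 i2
  refine ⟨hfin, ?_⟩
  rw [hval, v1, v2,
    h.sum_logDensity_moments_eq hl β (-G) _ _ hm,
    h'.sum_logDensity_moments_eq hl' β (-G) _ _ hm']
  -- the covariance of `q` enters through `K B - K B K G = K G`
  have hKG : (kernelMatrix β β * B).trace - (kernelMatrix β β * B * kernelMatrix β β * G).trace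
      = (kernelMatrix β β * G).trace := by
    have h1 : B * (1 + kernelMatrix β β * B) * (1 + kernelMatrix β β * B)⁻¹ = B := by
      rw [Matrix.mul_assoc, Matrix.mul_nonsing_inv _ hdet, Matrix.mul_one]
    have h2 : B = G + B * kernelMatrix β β * G := by
      conv_lhs => rw [← h1]
      rw [hG]
      noncomm_ring
    rw [sub_eq_iff_eq_add, ← Matrix.trace_add]
    conv_lhs => rw [h2]
    rw [Matrix.mul_add]
    simp only [Matrix.mul_assoc]
  simp only [inner_synthesis_precision_synthesis, inner_synthesis_synthesis, Matrix.mul_neg,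
    Matrix.trace_neg, Matrix.add_mul, Matrix.trace_add]
  simp only [Matrix.add_mulVec, dotProduct_add]
  linear_combination (-1 / 2) * hKG

end Divergence

end DecoupledGP

theorem mainTheorem1
    {H : Type*} [NormedAddCommGroup H] [InnerProductSpace ℝ H] [CompleteSpace H]
    {E : Type*} [NormedAddCommGroup E] [NormedSpace ℝ E] [CompleteSpace E]
    [SecondCountableTopology E] [MeasurableSpace E] [BorelSpace E]
    (i : H →L[ℝ] E) (ν : Measure E) (hν : IsAbstractWienerSpace i ν)
    {ια ιβ ια' ιβ' : Type*} [Fintype ια] [Fintype ιβ] [Fintype ια'] [Fintype ιβ']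
    [DecidableEq ιβ] [DecidableEq ιβ']
    (q : Measure E) (α : ια → H) (a : ια → ℝ) (β : ιβ → H) (B : Matrix ιβ ιβ ℝ)
    (hB : B.IsSymm) (hq : IsSubspaceGaussian i q α a β B)
    (p : Measure E) (α' : ια' → H) (a' : ια' → ℝ) (β' : ιβ' → H) (B' : Matrix ιβ' ιβ' ℝ)
    (hB' : B'.IsSymm) (hp : IsSubspaceGaussian i p α' a' β' B') :
    -- the terms of the formulas are well defined, and `B (I + K_β B)⁻¹` is `(B⁻¹ + K_β)⁻¹`
    (0 < (1 + kernelMatrix β β * B).det ∧ 0 < (1 + kernelMatrix β' β' * B').det ∧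
      (IsUnit B → IsUnit (B⁻¹ + kernelMatrix β β) ∧
        (B⁻¹ + kernelMatrix β β)⁻¹ = B * (1 + kernelMatrix β β * B)⁻¹)) ∧
    -- the general formula
    (klDiv q p ≠ ∞ ∧
      (klDiv q p).toReal =
        -(1 / 2) * ((kernelMatrix β β + kernelMatrix β β' * B' * kernelMatrix β' β) *
            (B * (1 + kernelMatrix β β * B)⁻¹)).trace
          + 1 / 2 * Real.log (1 + kernelMatrix β β * B).det
          + 1 / 2 * (a ⬝ᵥ (kernelMatrix α α + kernelMatrix α β' * B' * kernelMatrix β' α) *ᵥ a)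
          - a ⬝ᵥ (kernelMatrix α α' + kernelMatrix α β' * B' * kernelMatrix β' α') *ᵥ a'
          + 1 / 2 * ((kernelMatrix β' β' * B').trace
            - Real.log (1 + kernelMatrix β' β' * B').det
            + a' ⬝ᵥ (kernelMatrix α' α' + kernelMatrix α' β' * B' * kernelMatrix β' α') *ᵥ a')) ∧
    -- the special case of the standard normal measure
    (∀ p₀ : Measure E, IsGaussianWith i p₀ 0 1 →
      klDiv q p₀ ≠ ∞ ∧
      (klDiv q p₀).toReal =
        1 / 2 * (a ⬝ᵥ kernelMatrix α α *ᵥ a)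
          + 1 / 2 * Real.log (1 + kernelMatrix β β * B).det
          - 1 / 2 * (kernelMatrix β β * (B * (1 + kernelMatrix β β * B)⁻¹)).trace) := by
  have hdet := hq.det_pos hν.injective hB
  refine ⟨⟨hdet, hp.det_pos hν.injective hB', fun hBu => ?_⟩,
    klDiv_isSubspaceGaussian hν hB hq hB' hp, fun p₀ hp₀ => ?_⟩
  · have hBdet := (Matrix.isUnit_iff_isUnit_det B).1 hBu
    have h : (B⁻¹ + kernelMatrix β β) * (B * (1 + kernelMatrix β β * B)⁻¹) = 1 := by
      rw [← Matrix.mul_assoc, Matrix.add_mul, Matrix.nonsing_inv_mul _ hBdet,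
        Matrix.mul_nonsing_inv _ hdet.ne'.isUnit]
    exact ⟨(Matrix.isUnit_iff_isUnit_det _).2 (Matrix.isUnit_det_of_right_inverse h),
      Matrix.inv_eq_right_inv h⟩
  · -- `N(0, I)` is the case `B' = 0`, `a' = 0`, for any choice of the families
    have hp₁ : IsSubspaceGaussian i p₀ α (0 : ια → ℝ) β (0 : Matrix ιβ ιβ ℝ) := by
      refine ⟨by rw [precision_zero]; exact isUnit_one, ?_⟩
      rw [precision_zero, Ring.inverse_one, WithLp.toLp_zero, map_zero]
      exact hp₀
    obtain ⟨h1, h2⟩ := klDiv_isSubspaceGaussian hν hB hq Matrix.isSymm_zero hp₁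
    refine ⟨h1, h2.trans ?_⟩
    simp
    ring
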